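/- Let $\ell$ be a finite distributive lattice with least element $0$, greatest element $1$ and $0\neq 1$. Write $r\to s$ for its relative pseudo-complement, and for $r\in\ell$ let $T_r:\ell\to\ell$ be given by $T_r(x)=1$ if $x=r$ and $T_r(x)=0$ otherwise. An *$\ell$-VL-algebra* is an algebra $(A,\wedge,\vee,\to,T_r\,(r\in\ell),0,1)$ such that $(A,\wedge,\vee,\to,0,1)$ is a Heyting algebra and, for all $r,s\in\ell$ and $x,y\in A$ (with $x\leftrightarrow y:=(x\to y)\wedge(y\to x)$): 1. $T_r(x)\wedge T_s(y)\le T_{r\to s}(x\to y)\wedge T_{r\wedge s}(x\wedge y)\wedge T_{r\vee s}(x\vee y)$ and $T_s(x)\le T_{T_r(s)}(T_r(x))$; 2. $T_0(0)=1$, $T_r(0)=0$ for $r\ne 0$, $T_1(1)=1$, $T_r(1)=0$ for $r\neq 1$; 3. $\bigvee_{r\in\ell}T_r(x)=1$, $T_r(x)\wedge T_s(x)=0$ for $r\ne s$, and $T_r(x)\vee(T_r(x)\to 0)=1$; 4. $T_1(T_r(x))=T_r(x)$, $T_0(T_r(x))=T_r(x)\to 0$, and $T_s(T_r(x))=0$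 for $s\ne 0,1$; 5. $T_1(x)\le x$ and $T_1(x\wedge y)=T_1(x)\wedge T_1(y)$; 6. $\bigwedge_{r\in\ell}(T_r(x)\leftrightarrow T_r(y))\le (x\leftrightarrow y)$. Let $\ell$-$\mathbf{VA}$ be the category of $\ell$-VL-algebras and maps preserving $\wedge,\vee,\to,T_r\,(r\in\ell),0,1$. Let $\ell$-$\mathbf{BS}$ be the category of $\ell$-Boolean spaces. Its objects are the pairs $(S,\alpha)$ where $S$ is a Boolean space (a zero-dimensional compact Hausdorff space) and $\alpha$ assigns to each subalgebra $K$ of $(\ell,\wedge,\vee,\to,T_r\,(r\in\ell),0,1)$ a closed subspace $\alpha(K)$ of $S$, such that $\alpha(\ell)=S$ and $\alpha(K\cap M)=\alpha(K)\cap\alpha(M)$ for all subalgebras $K,M$. Its morphisms $(S,\alpha)\to(S',\beta)$ are the continuous maps $f:S\to S'$ such that $x\in\alpha(K)$ implies $f(x)\in\beta(K)$ for every subalgebra $K$. Then $\ell$-$\mathbf{VA}$ is dually equivalent to $\ell$-$\mathbf{BS}$: there is an equivalence of categories $(\ell\text{-}\mathbf{VA})^{op}\simeq\ell\text{-}\mathbf{BS}$.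 -/

import Mathlib

open CategoryTheory

universe u v

section LatticeOperations

variable {L : Type v} [DistribLattice L] [BoundedOrder L] [Fintype L]

open Classical in
/-- The relative pseudo-complement `a → b` of a finite distributive lattice: the join of all
`c` with `a ∧ c ≤ b`. -/
noncomputable def latImp (a b : L) : L :=
  (Finset.univ.filter fun c : L => a ⊓ c ≤ b).sup id

/-- `latImp` is the residual of the meet, i.e. the Heyting implication of the lattice. -/
theorem le_latImp_iff (a b c : L) : c ≤ latImp a b ↔ c ⊓ a ≤ b := by
  classical
  constructor
  · intro h
    have h1 : latImp a b ⊓ a ≤ b := by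
      rw [latImp, Finset.sup_inf_distrib_right]
      refine Finset.sup_le fun d hd => ?_
      have hd' := (Finset.mem_filter.mp hd).2
      simpa [inf_comm] using hd'
    exact (inf_le_inf_right a h).trans h1
  · intro h
    have hc : c ∈ Finset.univ.filter fun c : L => a ⊓ c ≤ b := by
      simpa [inf_comm] using h
    exact Finset.le_sup (f := id) hc

open Classical in
/-- The unary operation `T_a` on the lattice of truth values: `T_a(x) = 1` if `x = a`, and
`T_a(x) = 0` otherwise. -/
noncomputable def latT (a x : L) : L := if x = a then ⊤ else ⊥

end LatticeOperations

/-- `L`-`VL`-algebras over the finite distributive lattice `L` of truth values: Heyting algebras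
with unary operations `T a` (`a : L`) subject to Maruyama's equations. -/
class VLAlgebra (L : Type v) [DistribLattice L] [BoundedOrder L] [Fintype L]
    (A : Type u) [HeytingAlgebra A] where
  /-- The unary operations `T_a`, `a ∈ L`. -/
  T : L → A → A
  T_inf_T_le_himp : ∀ (a b : L) (x y : A), T a x ⊓ T b y ≤ T (latImp a b) (x ⇨ y)
  T_inf_T_le_inf : ∀ (a b : L) (x y : A), T a x ⊓ T b y ≤ T (a ⊓ b) (x ⊓ y)
  T_inf_T_le_sup : ∀ (a b : L) (x y : A), T a x ⊓ T b y ≤ T (a ⊔ b) (x ⊔ y)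
  T_le_T_T : ∀ (a b : L) (x : A), T b x ≤ T (latT a b) (T a x)
  T_bot_bot : T ⊥ ⊥ = ⊤
  T_bot : ∀ a : L, a ≠ ⊥ → T a ⊥ = ⊥
  T_top_top : T ⊤ ⊤ = ⊤
  T_top : ∀ a : L, a ≠ ⊤ → T a ⊤ = ⊥
  sup_T : ∀ x : A, (Finset.univ.sup fun a : L => T a x) = ⊤
  T_inf_T : ∀ (a b : L) (x : A), a ≠ b → T a x ⊓ T b x = ⊥
  T_sup_compl : ∀ (a : L) (x : A), T a x ⊔ (T a x ⇨ ⊥) = ⊤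
  T_top_T : ∀ (a : L) (x : A), T ⊤ (T a x) = T a x
  T_bot_T : ∀ (a : L) (x : A), T ⊥ (T a x) = (T a x ⇨ ⊥)
  T_T : ∀ (a b : L) (x : A), b ≠ ⊥ → b ≠ ⊤ → T b (T a x) = ⊥
  T_top_le : ∀ x : A, T ⊤ x ≤ x
  T_top_inf : ∀ x y : A, T ⊤ (x ⊓ y) = T ⊤ x ⊓ T ⊤ y
  inf_bihimp_le : ∀ x y : A,
    (Finset.univ.inf fun a : L => (T a x ⇨ T a y) ⊓ (T a y ⇨ T a x)) ≤ (x ⇨ y) ⊓ (y ⇨ x)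

/-- Homomorphisms of `L`-`VL`-algebras: maps that preserve `∧, ∨, →, T_a (a ∈ L), 0, 1`. -/
@[ext]
structure VLHom (L : Type v) [DistribLattice L] [BoundedOrder L] [Fintype L]
    (A B : Type u) [HeytingAlgebra A] [HeytingAlgebra B] [VLAlgebra L A] [VLAlgebra L B] where
  toFun : A → B
  map_inf : ∀ x y, toFun (x ⊓ y) = toFun x ⊓ toFun y
  map_sup : ∀ x y, toFun (x ⊔ y) = toFun x ⊔ toFun y
  map_himp : ∀ x y, toFun (x ⇨ y) = (toFun x ⇨ toFun y)
  map_T : ∀ (a : L) (x : A), toFun (VLAlgebra.T a x) = VLAlgebra.T a (toFun x)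
  map_bot : toFun ⊥ = ⊥
  map_top : toFun ⊤ = ⊤

/-- Objects of the category `L`-`VA`: all `L`-`VL`-algebras. -/
structure LVA (L : Type v) [DistribLattice L] [BoundedOrder L] [Fintype L] where
  carrier : Type u
  [heyting : HeytingAlgebra carrier]
  [alg : VLAlgebra L carrier]

attribute [instance] LVA.heyting LVA.alg

/-- The category `L`-`VA` of `L`-`VL`-algebras and homomorphisms. -/
instance LVA.category (L : Type v) [DistribLattice L] [BoundedOrder L] [Fintype L] :
    Category.{u} (LVA.{u} L) where
  Hom A B := VLHom L A.carrier B.carrier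
  id A :=
    { toFun := fun x => x
      map_inf := fun _ _ => rfl
      map_sup := fun _ _ => rfl
      map_himp := fun _ _ => rfl
      map_T := fun _ _ => rfl
      map_bot := rfl
      map_top := rfl }
  comp f g :=
    { toFun := fun x => g.toFun (f.toFun x)
      map_inf := fun x y => by rw [f.map_inf, g.map_inf]
      map_sup := fun x y => by rw [f.map_sup, g.map_sup]
      map_himp := fun x y => by rw [f.map_himp, g.map_himp]
      map_T := fun a x => by rw [f.map_T, g.map_T]
      map_bot := by rw [f.map_bot, g.map_bot]
      map_top := by rw [f.map_top, g.map_top] }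

/-- Subalgebras of `L` with respect to `∧, ∨, →, T_a (a ∈ L), 0, 1`. -/
@[ext]
structure LSubalg (L : Type v) [DistribLattice L] [BoundedOrder L] [Fintype L] where
  carrier : Set L
  inf_mem : ∀ {x y}, x ∈ carrier → y ∈ carrier → x ⊓ y ∈ carrier
  sup_mem : ∀ {x y}, x ∈ carrier → y ∈ carrier → x ⊔ y ∈ carrier
  imp_mem : ∀ {x y}, x ∈ carrier → y ∈ carrier → latImp x y ∈ carrier
  T_mem : ∀ (a : L) {x}, x ∈ carrier → latT a x ∈ carrier
  bot_mem : ⊥ ∈ carrier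
  top_mem : ⊤ ∈ carrier

namespace LSubalg

variable {L : Type v} [DistribLattice L] [BoundedOrder L] [Fintype L]

/-- `L` as a subalgebra of itself. -/
def whole : LSubalg L where
  carrier := Set.univ
  inf_mem _ _ := trivial
  sup_mem _ _ := trivial
  imp_mem _ _ := trivial
  T_mem _ _ _ := trivial
  bot_mem := trivial
  top_mem := trivial

/-- The intersection of two subalgebras. -/
def inter (K M : LSubalg L) : LSubalg L where
  carrier := K.carrier ∩ M.carrier
  inf_mem hx hy := ⟨K.inf_mem hx.1 hy.1, M.inf_mem hx.2 hy.2⟩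
  sup_mem hx hy := ⟨K.sup_mem hx.1 hy.1, M.sup_mem hx.2 hy.2⟩
  imp_mem hx hy := ⟨K.imp_mem hx.1 hy.1, M.imp_mem hx.2 hy.2⟩
  T_mem a _ hx := ⟨K.T_mem a hx.1, M.T_mem a hx.2⟩
  bot_mem := ⟨K.bot_mem, M.bot_mem⟩
  top_mem := ⟨K.top_mem, M.top_mem⟩

end LSubalg

/-- Objects `(S, α)` of the category `L`-`BS` of `L`-Boolean spaces: `S` is a Boolean space
(a zero-dimensional compact Hausdorff space) and `α` assigns to each subalgebra of `L` a closed
subspace of `S`, with `α(L) = S` and `α(K ∩ M) = α(K) ∩ α(M)`. -/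
structure LBS (L : Type v) [DistribLattice L] [BoundedOrder L] [Fintype L] where
  carrier : Type u
  [top : TopologicalSpace carrier]
  [compact : CompactSpace carrier]
  [t2 : T2Space carrier]
  zeroDim : TopologicalSpace.IsTopologicalBasis {U : Set carrier | IsClopen U}
  α : LSubalg L → Set carrier
  isClosed_α : ∀ K, IsClosed (α K)
  α_whole : α LSubalg.whole = Set.univ
  α_inter : ∀ K M, α (K.inter M) = α K ∩ α M

attribute [instance] LBS.top LBS.compact LBS.t2

/-- Morphisms `(S, α) → (S', β)` of `L`-Boolean spaces: continuous maps `f : S → S'` that are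
subspace-preserving, i.e. `x ∈ α(K)` implies `f x ∈ β(K)` for every subalgebra `K` of `L`. -/
@[ext]
structure LBSHom {L : Type v} [DistribLattice L] [BoundedOrder L] [Fintype L]
    (S S' : LBS.{u} L) where
  toFun : S.carrier → S'.carrier
  continuous_toFun : Continuous toFun
  map_mem : ∀ (K : LSubalg L) (x : S.carrier), x ∈ S.α K → toFun x ∈ S'.α K

/-- The category `L`-`BS` of `L`-Boolean spaces and subspace-preserving continuous maps. -/
instance LBS.category (L : Type v) [DistribLattice L] [BoundedOrder L] [Fintype L] :
    Category.{u} (LBS.{u} L) where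
  Hom S S' := LBSHom S S'
  id S :=
    { toFun := fun x => x
      continuous_toFun := continuous_id
      map_mem := fun _ _ h => h }
  comp f g :=
    { toFun := fun x => g.toFun (f.toFun x)
      continuous_toFun := g.continuous_toFun.comp f.continuous_toFun
      map_mem := fun K x h => g.map_mem K _ (f.map_mem K x h) }

/-! This is a Stone duality with `L` as dualizing object. An algebra goes to the space of its
homomorphisms to `L` (`VLPoint`), with `α K` the points whose values lie in `K`. A space goes to the
algebra `S.Cont` of locally constant, subspace-preserving functions to `L`. Both unit maps are
evaluations. For an algebra, evaluation is injective because prime ideals yield enough points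
(`VLPoint.eq_of_forall`). It is surjective because a subspace-preserving function is locally an
evaluation, and compactness with the two-valued terms `T_⊤ b` glues the pieces
(`VLPoint.exists_eval_eq`). For a space, every point of `S.Cont` is evaluation at some `x` by
compactness (`eval_surjective`), and `S.Cont` determines the sets `α K` (`LBS.mem_α_iff`). The
universe `max u v` keeps both constructions inside the two categories. -/

section LatticeFacts

variable {L : Type v} [DistribLattice L] [BoundedOrder L]

@[simp]
theorem latT_self (a : L) : latT a a = ⊤ := if_pos rfl

theorem latT_of_ne {a x : L} (h : x ≠ a) : latT a x = ⊥ := if_neg h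

theorem latT_eq_top_iff [Nontrivial L] {a x : L} : latT a x = ⊤ ↔ x = a := by
  unfold latT
  split_ifs with h <;> simp [h]

/-- The left side is `⊥` unless `x = a` and `y = b`. An arbitrary `op` covers the axioms for `∧`,
`∨` and `→` at once. -/
theorem latT_inf_latT_le (op : L → L → L) (a b x y : L) :
    latT a x ⊓ latT b y ≤ latT (op a b) (op x y) := by
  by_cases hx : x = a
  · by_cases hy : y = b
    · simp [hx, hy]
    · simp [latT_of_ne hy]
  · simp [latT_of_ne hx]

variable [Fintype L]

@[simp]
theorem latImp_self (a : L) : latImp a a = ⊤ :=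
  top_le_iff.mp ((le_latImp_iff _ _ _).mpr inf_le_right)

@[simp]
theorem latImp_top_left (a : L) : latImp ⊤ a = a :=
  eq_of_forall_le_iff fun c => by simp [le_latImp_iff]

@[simp]
theorem latImp_bot_left (a : L) : latImp ⊥ a = ⊤ :=
  top_le_iff.mp ((le_latImp_iff _ _ _).mpr (by simp))

end LatticeFacts

/-- The points of an `L`-`VL`-algebra: its homomorphisms to the algebra `L` of truth values. -/
@[ext]
structure VLPoint (L : Type v) [DistribLattice L] [BoundedOrder L] [Fintype L]
    (A : Type u) [HeytingAlgebra A] [VLAlgebra L A] where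
  toFun : A → L
  map_inf : ∀ x y, toFun (x ⊓ y) = toFun x ⊓ toFun y
  map_sup : ∀ x y, toFun (x ⊔ y) = toFun x ⊔ toFun y
  map_himp : ∀ x y, toFun (x ⇨ y) = latImp (toFun x) (toFun y)
  map_T : ∀ (a : L) (x : A), toFun (VLAlgebra.T a x) = latT a (toFun x)
  map_bot : toFun ⊥ = ⊥
  map_top : toFun ⊤ = ⊤

namespace VLPoint

variable {L : Type v} [DistribLattice L] [BoundedOrder L] [Fintype L]
variable {A : Type u} [HeytingAlgebra A] [VLAlgebra L A]

theorem mono (w : VLPoint L A) {x y : A} (h : x ≤ y) : w.toFun x ≤ w.toFun y := by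
  rw [← inf_eq_left, ← w.map_inf, inf_eq_left.mpr h]

theorem map_compl (w : VLPoint L A) (x : A) : w.toFun xᶜ = latImp (w.toFun x) ⊥ := by
  rw [← himp_bot, w.map_himp, w.map_bot]

theorem map_finset_inf {ι : Type*} (w : VLPoint L A) (s : Finset ι) (f : ι → A) :
    w.toFun (s.inf f) = s.inf fun i => w.toFun (f i) :=
  Finset.apply_inf_eq_inf_comp w.toFun w.map_inf w.map_top

/-- The values of a point form a subalgebra of `L`. -/
def range (w : VLPoint L A) : LSubalg L where
  carrier := Set.range w.toFun
  inf_mem := by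
    rintro _ _ ⟨x, rfl⟩ ⟨y, rfl⟩
    exact ⟨x ⊓ y, w.map_inf x y⟩
  sup_mem := by
    rintro _ _ ⟨x, rfl⟩ ⟨y, rfl⟩
    exact ⟨x ⊔ y, w.map_sup x y⟩
  imp_mem := by
    rintro _ _ ⟨x, rfl⟩ ⟨y, rfl⟩
    exact ⟨x ⇨ y, w.map_himp x y⟩
  T_mem := by
    rintro a _ ⟨x, rfl⟩
    exact ⟨VLAlgebra.T a x, w.map_T a x⟩
  bot_mem := ⟨⊥, w.map_bot⟩
  top_mem := ⟨⊤, w.map_top⟩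

/-! ### Prime ideals and separation by points -/

section PrimeIdeal

-- A value exists because the join of all `T_a x` is `⊤`, which a proper ideal omits. It is unique
-- because distinct `T_a x`, `T_b x` meet in `⊥ ∈ P` and `P` is prime.
variable (L) in
theorem existsUnique_T_notMem (P : Order.Ideal A) [hP : P.IsPrime] (x : A) :
    ∃! a : L, VLAlgebra.T a x ∉ P := by
  classical
  obtain ⟨a, ha⟩ : ∃ a : L, VLAlgebra.T a x ∉ P := by
    by_contra! h
    refine hP.top_notMem ?_
    rw [← VLAlgebra.sup_T (L := L) x]
    refine Finset.sup_induction P.bot_mem (fun _ h₁ _ h₂ => Order.Ideal.sup_mem h₁ h₂)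
      fun a _ => h a
  refine ⟨a, ha, fun b hb => by_contra fun hne => ?_⟩
  rcases hP.mem_or_mem (x := VLAlgebra.T b x) (y := VLAlgebra.T a x)
    (by rw [VLAlgebra.T_inf_T b a x hne]; exact P.bot_mem) with h | h
  exacts [hb h, ha h]

/-- A prime ideal `P` yields the point which sends `x` to the unique `a` with `T_a x ∉ P`. -/
noncomputable def ofPrime (P : Order.Ideal A) [hP : P.IsPrime] : VLPoint L A :=
  have key {a : L} {x : A} (h : VLAlgebra.T a x ∉ P) :
      (existsUnique_T_notMem L P x).choose = a :=
    (existsUnique_T_notMem L P x).unique (existsUnique_T_notMem L P x).choose_spec.1 h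
  have spec (x : A) : VLAlgebra.T (existsUnique_T_notMem L P x).choose x ∉ P :=
    (existsUnique_T_notMem L P x).choose_spec.1
  have inf_notMem {x y z : A} (hx : x ∉ P) (hy : y ∉ P) (h : x ⊓ y ≤ z) : z ∉ P := fun hz =>
    (hP.mem_or_mem (P.lower h hz)).elim hx hy
  have top_notMem : (⊤ : A) ∉ P := hP.top_notMem
  { toFun := fun x => (existsUnique_T_notMem L P x).choose
    map_inf := fun x y => key (inf_notMem (spec x) (spec y) (VLAlgebra.T_inf_T_le_inf _ _ x y))
    map_sup := fun x y => key (inf_notMem (spec x) (spec y) (VLAlgebra.T_inf_T_le_sup _ _ x y))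
    map_himp := fun x y => key (inf_notMem (spec x) (spec y) (VLAlgebra.T_inf_T_le_himp _ _ x y))
    map_T := fun a x => key fun h => spec x (P.lower (VLAlgebra.T_le_T_T a _ x) h)
    map_bot := key (by rw [VLAlgebra.T_bot_bot]; exact top_notMem)
    map_top := key (by rw [VLAlgebra.T_top_top]; exact top_notMem) }

theorem ofPrime_eq_iff (P : Order.Ideal A) [P.IsPrime] (x : A) (a : L) :
    (ofPrime P : VLPoint L A).toFun x = a ↔ VLAlgebra.T a x ∉ P := by
  constructor
  · rintro rfl
    exact (existsUnique_T_notMem L P x).choose_spec.1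
  · exact (existsUnique_T_notMem L P x).unique (existsUnique_T_notMem L P x).choose_spec.1

/-- Otherwise some prime ideal `P` contains the implication, hence `T_a y`. As `T_a x` is
complemented, it stays outside `P`, so the point of `P` takes the value `a` at `x` but not at `y`.
-/
theorem T_himp_eq_top {x y : A} (h : ∀ w : VLPoint L A, w.toFun x = w.toFun y) (a : L) :
    VLAlgebra.T a x ⇨ VLAlgebra.T a y = ⊤ := by
  by_contra hne
  obtain ⟨P, hP, hcP, -⟩ := DistribLattice.prime_ideal_of_disjoint_filter_ideal
    (F := Order.PFilter.principal (⊤ : A))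
    (I := Order.Ideal.principal (VLAlgebra.T a x ⇨ VLAlgebra.T a y))
    (Set.disjoint_left.mpr fun z hz hz' => hne (top_le_iff.mp
      ((Order.PFilter.mem_principal.mp hz).trans (Order.Ideal.mem_principal.mp hz'))))
  have hmem : VLAlgebra.T a x ⇨ VLAlgebra.T a y ∈ P := hcP (Order.Ideal.mem_principal.mpr le_rfl)
  have hy : VLAlgebra.T a y ∈ P := P.lower le_himp hmem
  have hx : VLAlgebra.T a x ∉ P := fun hx => by
    refine hP.top_notMem ?_
    -- The complement `T_a x ⇨ ⊥` lies below the implication, so it belongs to `P` too.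
    rw [← VLAlgebra.T_sup_compl a x]
    exact Order.Ideal.sup_mem hx (P.lower (himp_le_himp_left bot_le) hmem)
  have hwx := (ofPrime_eq_iff P x a).mpr hx
  rw [h] at hwx
  exact (ofPrime_eq_iff P y a).mp hwx hy

/-- The points separate the elements of the algebra. -/
theorem eq_of_forall {x y : A} (h : ∀ w : VLPoint L A, w.toFun x = w.toFun y) : x = y := by
  have hle := VLAlgebra.inf_bihimp_le (L := L) x y
  simp only [T_himp_eq_top h, T_himp_eq_top fun w => (h w).symm, inf_idem] at hle
  rw [(Finset.inf_eq_top_iff _ _).mpr fun _ _ => rfl, top_le_iff, inf_eq_top_iff,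
    himp_eq_top_iff, himp_eq_top_iff] at hle
  exact le_antisymm hle.1 hle.2

end PrimeIdeal

/-! ### Topology of the spectrum -/

/-- The topology of pointwise convergence, for the discrete topology on `L`. -/
instance : TopologicalSpace (VLPoint L A) :=
  .induced toFun (@Pi.topologicalSpace A (fun _ => L) fun _ => ⊥)

theorem toFun_injective : Function.Injective (toFun : VLPoint L A → A → L) :=
  fun _ _ => VLPoint.ext

/-- Homomorphisms are cut out of `A → L` by equations between finitely many coordinates, which are
closed conditions for discrete `L`. -/
theorem isClosedEmbedding_toFun [TopologicalSpace L] [DiscreteTopology L] :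
    Topology.IsClosedEmbedding (toFun : VLPoint L A → A → L) := by
  refine ⟨⟨⟨?_⟩, toFun_injective⟩, ?_⟩
  · rw [DiscreteTopology.eq_bot (α := L)]
    rfl
  have hrange : Set.range (toFun : VLPoint L A → A → L) =
      {f | (∀ x y, f (x ⊓ y) = f x ⊓ f y) ∧ (∀ x y, f (x ⊔ y) = f x ⊔ f y) ∧
        (∀ x y, f (x ⇨ y) = latImp (f x) (f y)) ∧
        (∀ (a : L) x, f (VLAlgebra.T a x) = latT a (f x)) ∧ f ⊥ = ⊥ ∧ f ⊤ = ⊤} := by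
    ext f
    constructor
    · rintro ⟨w, rfl⟩
      exact ⟨w.map_inf, w.map_sup, w.map_himp, w.map_T, w.map_bot, w.map_top⟩
    · rintro ⟨h₁, h₂, h₃, h₄, h₅, h₆⟩
      exact ⟨⟨f, h₁, h₂, h₃, h₄, h₅, h₆⟩, rfl⟩
  have binary (m : A → A → A) (op : L → L → L) :
      IsClosed {f : A → L | ∀ x y, f (m x y) = op (f x) (f y)} := by
    simp only [Set.ofPred_forall]
    exact isClosed_iInter fun x => isClosed_iInter fun y => isClosed_eq (continuous_apply _)
      ((continuous_of_discreteTopology (f := fun p : L × L => op p.1 p.2)).comp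
        ((continuous_apply (A := fun _ : A => L) x).prodMk (continuous_apply y)))
  have unary : IsClosed {f : A → L | ∀ (a : L) x, f (VLAlgebra.T a x) = latT a (f x)} := by
    simp only [Set.ofPred_forall]
    exact isClosed_iInter fun a => isClosed_iInter fun x => isClosed_eq (continuous_apply _)
      ((continuous_of_discreteTopology (f := latT a)).comp (continuous_apply x))
  rw [hrange]
  exact (binary _ _).inter ((binary _ _).inter ((binary _ _).inter (unary.inter
    ((isClosed_eq (continuous_apply _) continuous_const).inter
      (isClosed_eq (continuous_apply _) continuous_const)))))

instance : CompactSpace (VLPoint L A) :=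
  let _ : TopologicalSpace L := ⊥
  have _ : DiscreteTopology L := ⟨rfl⟩
  isClosedEmbedding_toFun.compactSpace

instance : T2Space (VLPoint L A) :=
  let _ : TopologicalSpace L := ⊥
  have _ : DiscreteTopology L := ⟨rfl⟩
  isClosedEmbedding_toFun.isEmbedding.t2Space

theorem isLocallyConstant_eval (x : A) : IsLocallyConstant fun w : VLPoint L A => w.toFun x := by
  let _ : TopologicalSpace L := ⊥
  have _ : DiscreteTopology L := ⟨rfl⟩
  rw [IsLocallyConstant.iff_continuous]
  exact (continuous_apply x).comp isClosedEmbedding_toFun.continuous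

theorem continuous_iff {X : Type*} [TopologicalSpace X] {f : X → VLPoint L A} :
    Continuous f ↔ ∀ x, IsLocallyConstant fun p => (f p).toFun x := by
  let _ : TopologicalSpace L := ⊥
  have _ : DiscreteTopology L := ⟨rfl⟩
  simp_rw [IsLocallyConstant.iff_continuous, isClosedEmbedding_toFun.continuous_iff,
    continuous_pi_iff, Function.comp_def]

variable [Nontrivial L]

/-- A basic open set constrains finitely many values. Agreeing with `w` at `x` means sending `T_(w
x) x` to `⊤`, and a finite meet combines these conditions into one element. -/
theorem exists_basic_nhd {w : VLPoint L A} {U : Set (VLPoint L A)} (hU : IsOpen U) (hw : w ∈ U) :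
    ∃ b : A, w.toFun b = ⊤ ∧ ∀ w' : VLPoint L A, w'.toFun b = ⊤ → w' ∈ U := by
  let _ : TopologicalSpace L := ⊥
  have _ : DiscreteTopology L := ⟨rfl⟩
  obtain ⟨V, hV, rfl⟩ := isClosedEmbedding_toFun.isInducing.isOpen_iff.mp hU
  obtain ⟨I, u, hu, huV⟩ := isOpen_pi_iff.mp hV w.toFun hw
  refine ⟨I.inf fun x => VLAlgebra.T (w.toFun x) x, ?_, fun w' hw' => huV fun x hx => ?_⟩
  · simp [map_finset_inf, map_T]
  · rw [map_finset_inf, Finset.inf_eq_top_iff] at hw'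
    have := hw' x hx
    rw [map_T, latT_eq_top_iff] at this
    rw [this]
    exact (hu x hx).2

theorem isTopologicalBasis_isClopen :
    TopologicalSpace.IsTopologicalBasis {U : Set (VLPoint L A) | IsClopen U} := by
  refine TopologicalSpace.isTopologicalBasis_of_isOpen_of_nhds (fun U hU => hU.isOpen) ?_
  intro w U hw hU
  obtain ⟨b, hb, hbU⟩ := exists_basic_nhd hU hw
  exact ⟨{w' | w'.toFun b = ⊤}, (isLocallyConstant_eval b).isClopen_fiber ⊤, hb, hbU⟩

/-- A locally constant function on the points which takes at each point one of the values of that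
point is the evaluation at an element of the algebra. -/
theorem exists_eval_eq {f : VLPoint L A → L} (hf : IsLocallyConstant f)
    (hmem : ∀ w, f w ∈ Set.range w.toFun) : ∃ x : A, ∀ w : VLPoint L A, w.toFun x = f w := by
  -- The element `c` represents `f` on a set defined by `b`, not merely on `s`, so that pieces can
  -- be glued by terms of the algebra.
  let p (s : Set (VLPoint L A)) : Prop := ∃ b c : A, (∀ w ∈ s, w.toFun b = ⊤) ∧
    ∀ w : VLPoint L A, w.toFun b = ⊤ → w.toFun c = f w
  have huniv : p Set.univ := by
    refine isCompact_univ.induction_on (p := p) ?_ ?_ ?_ ?_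
    · exact ⟨⊥, ⊥, by simp, fun w hw => absurd (w.map_bot.symm.trans hw) bot_ne_top⟩
    · rintro s t hst ⟨b, c, hb, hc⟩
      exact ⟨b, c, fun w hw => hb w (hst hw), hc⟩
    · rintro s t ⟨b, c, hb, hc⟩ ⟨b', c', hb', hc'⟩
      -- Applying `T_⊤` makes the selectors two-valued: a plain `b ⊔ b'` could be `⊤` where neither
      -- `b` nor `b'` is. The second term reads "`c` where `b = ⊤`, else `c'`".
      refine ⟨VLAlgebra.T (⊤ : L) b ⊔ VLAlgebra.T (⊤ : L) b',
        (VLAlgebra.T (⊤ : L) b ⊓ c) ⊔ ((VLAlgebra.T (⊤ : L) b)ᶜ ⊓ c'), ?_, ?_⟩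
      · rintro w (hw | hw)
        · simp [map_sup, map_T, hb w hw]
        · simp [map_sup, map_T, hb' w hw]
      · intro w hw
        by_cases h : w.toFun b = ⊤
        · simp [map_sup, map_inf, map_compl, map_T, h, hc w h]
        · rw [map_sup, map_T, map_T, latT_of_ne h, bot_sup_eq, latT_eq_top_iff] at hw
          simp [map_sup, map_inf, map_compl, map_T, latT_of_ne h, hc' w hw]
    -- Near `w`, the function `f` agrees with evaluation at any `x` having `w x = f w`, both being
    -- locally constant.
    · intro w _
      obtain ⟨x, hx⟩ := hmem w
      obtain ⟨b, hb, hbU⟩ := exists_basic_nhd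
        ((hf.isOpen_fiber (f w)).inter ((isLocallyConstant_eval x).isOpen_fiber (f w)))
        (show w ∈ _ from ⟨rfl, hx⟩)
      refine ⟨{w' | w'.toFun b = ⊤}, mem_nhdsWithin_of_mem_nhds
        (((isLocallyConstant_eval b).isOpen_fiber ⊤).mem_nhds hb), b, x, fun _ h => h, ?_⟩
      intro w' hw'
      exact (hbU w' hw').2.trans (hbU w' hw').1.symm
  obtain ⟨b, c, hb, hc⟩ := huniv
  exact ⟨c, fun w => hc w (hb w trivial)⟩

end VLPoint

/-! ### The algebra of functions on a space -/

/-- Continuous subspace-preserving functions from an `L`-Boolean space to `L`. -/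
def LBS.Cont {L : Type v} [DistribLattice L] [BoundedOrder L] [Fintype L] (S : LBS.{u} L) :
    Type (max u v) :=
  {f : S.carrier → L // IsLocallyConstant f ∧ ∀ (K : LSubalg L) (x), x ∈ S.α K → f x ∈ K.carrier}

namespace LBS.Cont

variable {L : Type v} [DistribLattice L] [BoundedOrder L] [Fintype L] {S : LBS.{u} L}

noncomputable instance : HeytingAlgebra S.Cont where
  le f g := ∀ x, f.1 x ≤ g.1 x
  le_refl f x := le_rfl
  le_trans f g h hfg hgh x := (hfg x).trans (hgh x)
  le_antisymm f g hfg hgf := Subtype.ext (funext fun x => le_antisymm (hfg x) (hgf x))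
  sup f g := ⟨fun x => f.1 x ⊔ g.1 x, f.2.1.comp₂ g.2.1 (· ⊔ ·),
    fun K x hx => K.sup_mem (f.2.2 K x hx) (g.2.2 K x hx)⟩
  le_sup_left f g x := le_sup_left
  le_sup_right f g x := le_sup_right
  sup_le f g h hfh hgh x := sup_le (hfh x) (hgh x)
  inf f g := ⟨fun x => f.1 x ⊓ g.1 x, f.2.1.comp₂ g.2.1 (· ⊓ ·),
    fun K x hx => K.inf_mem (f.2.2 K x hx) (g.2.2 K x hx)⟩
  inf_le_left f g x := inf_le_left
  inf_le_right f g x := inf_le_right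
  le_inf f g h hfg hfh x := le_inf (hfg x) (hfh x)
  top := ⟨fun _ => ⊤, IsLocallyConstant.const _, fun K _ _ => K.top_mem⟩
  le_top f x := le_top
  bot := ⟨fun _ => ⊥, IsLocallyConstant.const _, fun K _ _ => K.bot_mem⟩
  bot_le f x := bot_le
  himp f g := ⟨fun x => latImp (f.1 x) (g.1 x), f.2.1.comp₂ g.2.1 latImp,
    fun K x hx => K.imp_mem (f.2.2 K x hx) (g.2.2 K x hx)⟩
  le_himp_iff f g h := forall_congr' fun x => le_latImp_iff _ _ _
  compl f := ⟨fun x => latImp (f.1 x) ⊥, f.2.1.comp (latImp · ⊥),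
    fun K x hx => K.imp_mem (f.2.2 K x hx) K.bot_mem⟩
  himp_bot f := rfl

theorem le_def {f g : S.Cont} : f ≤ g ↔ ∀ x, f.1 x ≤ g.1 x := Iff.rfl

theorem ext {f g : S.Cont} (h : ∀ x, f.1 x = g.1 x) : f = g := Subtype.ext (funext h)

@[simp] theorem inf_apply (f g : S.Cont) (x : S.carrier) : (f ⊓ g).1 x = f.1 x ⊓ g.1 x := rfl
@[simp] theorem sup_apply (f g : S.Cont) (x : S.carrier) : (f ⊔ g).1 x = f.1 x ⊔ g.1 x := rfl
@[simp] theorem himp_apply (f g : S.Cont) (x : S.carrier) :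
    (f ⇨ g).1 x = latImp (f.1 x) (g.1 x) := rfl
@[simp] theorem compl_apply (f : S.Cont) (x : S.carrier) : fᶜ.1 x = latImp (f.1 x) ⊥ := rfl
@[simp] theorem bot_apply (x : S.carrier) : (⊥ : S.Cont).1 x = ⊥ := rfl
@[simp] theorem top_apply (x : S.carrier) : (⊤ : S.Cont).1 x = ⊤ := rfl

/-- The pointwise operation `T_a`. -/
noncomputable def T (a : L) (f : S.Cont) : S.Cont :=
  ⟨fun x => latT a (f.1 x), f.2.1.comp (latT a), fun K x hx => K.T_mem a (f.2.2 K x hx)⟩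

@[simp] theorem T_apply (a : L) (f : S.Cont) (x : S.carrier) : (T a f).1 x = latT a (f.1 x) := rfl

noncomputable instance [Nontrivial L] : VLAlgebra L S.Cont where
  T := T
  T_inf_T_le_himp a b f g x := latT_inf_latT_le latImp a b _ _
  T_inf_T_le_inf a b f g x := latT_inf_latT_le (· ⊓ ·) a b _ _
  T_inf_T_le_sup a b f g x := latT_inf_latT_le (· ⊔ ·) a b _ _
  T_le_T_T a b f x := by
    by_cases h : f.1 x = b
    · simp [h]
    · simp [latT_of_ne h]
  T_bot_bot := ext fun x => by simp
  T_bot a ha := ext fun x => latT_of_ne ha.symm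
  T_top_top := ext fun x => by simp
  T_top a ha := ext fun x => latT_of_ne ha.symm
  sup_T f := top_le_iff.mp fun x => by
    simpa using le_def.mp (Finset.le_sup (f := fun a => T a f) (Finset.mem_univ (f.1 x))) x
  T_inf_T a b f hab := ext fun x => by
    by_cases h : f.1 x = a
    · simp [h, latT_of_ne hab]
    · simp [latT_of_ne h]
  T_sup_compl a f := ext fun x => by
    by_cases h : f.1 x = a
    · simp [h]
    · simp [latT_of_ne h]
  T_top_T a f := ext fun x => by
    by_cases h : f.1 x = a
    · simp [h]
    · simp [latT_of_ne h, latT_of_ne (bot_ne_top (α := L))]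
  T_bot_T a f := ext fun x => by
    by_cases h : f.1 x = a
    · simp [h, latT_of_ne (top_ne_bot (α := L))]
    · simp [latT_of_ne h]
  T_T a b f hb ht := ext fun x => by
    by_cases h : f.1 x = a
    · simp [h, latT_of_ne ht.symm]
    · simp [latT_of_ne h, latT_of_ne hb.symm]
  T_top_le f x := by
    by_cases h : f.1 x = ⊤
    · simp [h]
    · simp [latT_of_ne h]
  T_top_inf f g := ext fun x => by
    by_cases hf : f.1 x = ⊤
    · simp [hf]
    · have h : f.1 x ⊓ g.1 x ≠ ⊤ := fun h => hf (inf_eq_top_iff.mp h).1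
      simp [latT_of_ne hf, latT_of_ne h]
  inf_bihimp_le f g x := by
    by_cases h : f.1 x = g.1 x
    · simp [h]
    -- The index `a = f x` suffices: there `T_a f` is `⊤` and `T_a g` is `⊥`.
    · have := le_def.mp (Finset.inf_le (f := fun a => (T a f ⇨ T a g) ⊓ (T a g ⇨ T a f))
        (Finset.mem_univ (f.1 x))) x
      refine this.trans ?_
      simp [latT_of_ne (Ne.symm h)]

theorem vlT_apply [Nontrivial L] (a : L) (f : S.Cont) (x : S.carrier) :
    (VLAlgebra.T a f).1 x = latT a (f.1 x) := rfl

open Classical in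
/-- The function with value `r` on a clopen set and `⊥` outside of it. -/
noncomputable def ofClopen (U : Set S.carrier) (hU : IsClopen U) (r : L)
    (h : ∀ (K : LSubalg L), ∀ x ∈ U, x ∈ S.α K → r ∈ K.carrier) : S.Cont :=
  ⟨fun x => if x ∈ U then r else ⊥, by
    refine (IsLocallyConstant.iff_exists_open _).mpr fun x => ?_
    by_cases hx : x ∈ U
    · exact ⟨U, hU.isOpen, hx, fun y hy => by simp [hx, hy]⟩
    · exact ⟨Uᶜ, hU.compl.isOpen, hx, fun y hy => by
        simp [hx, (Set.mem_compl_iff _ _).mp hy]⟩, fun K x hx => by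
    dsimp only
    split_ifs with hxU
    exacts [h K x hxU hx, K.bot_mem]⟩

theorem ofClopen_of_mem {U : Set S.carrier} {hU : IsClopen U} {r : L} {h} {x : S.carrier}
    (hx : x ∈ U) : (ofClopen U hU r h).1 x = r := if_pos hx

theorem ofClopen_of_notMem {U : Set S.carrier} {hU : IsClopen U} {r : L} {h} {x : S.carrier}
    (hx : x ∉ U) : (ofClopen U hU r h).1 x = ⊥ := if_neg hx

/-! ### Points of the function algebra -/

variable [Nontrivial L]

/-- Evaluation at an element of an `L`-Boolean space. -/
def eval (x : S.carrier) : VLPoint L S.Cont where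
  toFun f := f.1 x
  map_inf _ _ := rfl
  map_sup _ _ := rfl
  map_himp _ _ := rfl
  map_T _ _ := rfl
  map_bot := rfl
  map_top := rfl

theorem continuous_eval : Continuous (eval : S.carrier → VLPoint L S.Cont) :=
  VLPoint.continuous_iff.mpr fun f => f.2.1

/-- Indicators of clopen sets separate points, and they preserve subspaces since `⊤` and `⊥` lie in
every subalgebra. -/
theorem eval_injective : Function.Injective (eval : S.carrier → VLPoint L S.Cont) := by
  intro x y hxy
  by_contra hne
  obtain ⟨U, hU, hxU, hUy⟩ := S.zeroDim.exists_subset_of_mem_open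
    (show x ∈ ({y}ᶜ : Set S.carrier) from hne) isOpen_compl_singleton
  have h := congrArg (fun w => w.toFun (ofClopen U hU ⊤ fun K _ _ _ => K.top_mem)) hxy
  change (ofClopen U hU ⊤ fun K _ _ _ => K.top_mem).1 x
    = (ofClopen U hU ⊤ fun K _ _ _ => K.top_mem).1 y at h
  rw [ofClopen_of_mem hxU, ofClopen_of_notMem fun hy => hUy hy rfl] at h
  exact top_ne_bot h

/-- The required `x` lies in all the closed fibres `f x = w f`. If finitely many of them had empty
intersection, the meet of the corresponding `T_(w f) f` would be `⊥`, yet `w` sends it to `⊤`. -/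
theorem eval_surjective : Function.Surjective (eval : S.carrier → VLPoint L S.Cont) := by
  intro w
  have hne : (⋂ f : S.Cont, {x | f.1 x = w.toFun f}).Nonempty := by
    refine CompactSpace.iInter_nonempty (fun f => f.2.1.isClosed_fiber _) fun I => ?_
    by_contra hempty
    have hbot : (I.inf fun f => VLAlgebra.T (w.toFun f) f) = ⊥ := ext fun x => by
      have hx : ∃ f ∈ I, f.1 x ≠ w.toFun f := by
        by_contra! h
        exact hempty ⟨x, Set.mem_iInter₂.mpr h⟩
      obtain ⟨f, hf, hfx⟩ := hx
      have hle := le_def.mp (Finset.inf_le (f := fun f => VLAlgebra.T (w.toFun f) f) hf) x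
      rw [vlT_apply, latT_of_ne hfx] at hle
      exact le_bot_iff.mp hle
    have htop : w.toFun (I.inf fun f => VLAlgebra.T (w.toFun f) f) = ⊤ := by
      simp [VLPoint.map_finset_inf, VLPoint.map_T]
    rw [hbot, w.map_bot] at htop
    exact bot_ne_top htop
  obtain ⟨x, hx⟩ := hne
  exact ⟨x, VLPoint.ext (funext fun f => Set.mem_iInter.mp hx f)⟩

end LBS.Cont

/-! ### Recovering the subspaces from the functions -/

namespace LBS

variable {L : Type v} [DistribLattice L] [BoundedOrder L] [Fintype L]

theorem α_mono (S : LBS.{u} L) {K M : LSubalg L} (h : K.carrier ⊆ M.carrier) :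
    S.α K ⊆ S.α M := by
  have hKM : K.inter M = K := LSubalg.ext (Set.inter_eq_left.mpr h)
  rw [← hKM, S.α_inter]
  exact Set.inter_subset_right

instance : Finite (LSubalg L) :=
  Finite.of_injective LSubalg.carrier fun _ _ => LSubalg.ext

/-- Each element `x` lies in `α N` for a least subalgebra `N`. -/
theorem exists_least (S : LBS.{u} L) (x : S.carrier) :
    ∃ N, x ∈ S.α N ∧ ∀ M, x ∈ S.α M → N.carrier ⊆ M.carrier := by
  obtain ⟨N, hN, hmin⟩ := Set.Finite.exists_minimalFor LSubalg.carrier {M | x ∈ S.α M}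
    (Set.toFinite _) ⟨LSubalg.whole, by simp [S.α_whole]⟩
  refine ⟨N, hN, fun M hM => ?_⟩
  -- Closure under intersection upgrades minimal to least.
  have hNM : x ∈ S.α (N.inter M) := by
    rw [S.α_inter]
    exact ⟨hN, hM⟩
  exact (hmin hNM Set.inter_subset_left).trans Set.inter_subset_right

/-- If `x ∉ α K`, the least `N` with `x ∈ α N` contains some `r ∉ K`. The finitely many closed sets
`α M` with `r ∉ M` miss `x`, so a clopen neighbourhood of `x` avoids them. The function equal to `r`
there and `⊥` elsewhere preserves subspaces and takes the value `r ∉ K` at `x`. -/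
theorem mem_α_iff (S : LBS.{u} L) (K : LSubalg L) (x : S.carrier) :
    x ∈ S.α K ↔ ∀ f : S.Cont, f.1 x ∈ K.carrier := by
  refine ⟨fun hx f => f.2.2 K x hx, fun h => by_contra fun hx => ?_⟩
  obtain ⟨N, hN, hleast⟩ := S.exists_least x
  obtain ⟨r, hrN, hrK⟩ := Set.not_subset.mp fun hNK => hx (S.α_mono hNK hN)
  have hclosed : IsClosed (⋃ M ∈ {M : LSubalg L | r ∉ M.carrier}, S.α M) :=
    (Set.toFinite _).isClosed_biUnion fun M _ => S.isClosed_α M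
  obtain ⟨U, hU, hxU, hUα⟩ := S.zeroDim.exists_subset_of_mem_open
    (show x ∈ (⋃ M ∈ {M : LSubalg L | r ∉ M.carrier}, S.α M)ᶜ from fun hmem => by
      obtain ⟨M, hrM, hxM⟩ := Set.mem_iUnion₂.mp hmem
      exact hrM (hleast M hxM hrN)) hclosed.isOpen_compl
  have hf := h (Cont.ofClopen U hU r fun M y hyU hyM => by_contra fun hrM =>
    hUα hyU (Set.mem_iUnion₂.mpr ⟨M, hrM, hyM⟩))
  rw [Cont.ofClopen_of_mem hxU] at hf
  exact hrK hf

/-- A bijective morphism that reflects the subspaces is an isomorphism. -/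
noncomputable def isoOfBijective {S S' : LBS.{u} L} (f : S ⟶ S')
    (hf : Function.Bijective f.toFun) (hα : ∀ K x, f.toFun x ∈ S'.α K → x ∈ S.α K) : S ≅ S' :=
  let e := Equiv.ofBijective f.toFun hf
  { hom := f
    inv :=
      { toFun := e.symm
        continuous_toFun := Continuous.continuous_symm_of_equiv_compact_to_t2
          (f := e) f.continuous_toFun
        map_mem := fun K y hy => hα K _ (by
          rwa [show f.toFun (e.symm y) = y from e.apply_symm_apply y]) }
    hom_inv_id := LBSHom.ext (funext e.symm_apply_apply)
    inv_hom_id := LBSHom.ext (funext e.apply_symm_apply) }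

end LBS

namespace LVA

variable {L : Type v} [DistribLattice L] [BoundedOrder L] [Fintype L]

/-- A bijective homomorphism is an isomorphism. -/
noncomputable def isoOfBijective {A B : LVA.{u} L} (f : A ⟶ B)
    (hf : Function.Bijective f.toFun) : A ≅ B :=
  let e := Equiv.ofBijective f.toFun hf
  have he (y : B.carrier) : f.toFun (e.symm y) = y := e.apply_symm_apply y
  { hom := f
    inv :=
      { toFun := e.symm
        map_inf := fun x y => hf.1 (by simp only [f.map_inf, he])
        map_sup := fun x y => hf.1 (by simp only [f.map_sup, he])
        map_himp := fun x y => hf.1 (by simp only [f.map_himp, he])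
        map_T := fun a x => hf.1 (by simp only [f.map_T, he])
        map_bot := hf.1 (by simp only [f.map_bot, he])
        map_top := hf.1 (by simp only [f.map_top, he]) }
    hom_inv_id := VLHom.ext (funext e.symm_apply_apply)
    inv_hom_id := VLHom.ext (funext e.apply_symm_apply) }

end LVA

/-- Composition of a point with a homomorphism. -/
def VLPoint.comp {L : Type v} [DistribLattice L] [BoundedOrder L] [Fintype L]
    {A B : Type u} [HeytingAlgebra A] [HeytingAlgebra B] [VLAlgebra L A] [VLAlgebra L B]
    (w : VLPoint L B) (f : VLHom L A B) : VLPoint L A where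
  toFun x := w.toFun (f.toFun x)
  map_inf x y := by rw [f.map_inf, w.map_inf]
  map_sup x y := by rw [f.map_sup, w.map_sup]
  map_himp x y := by rw [f.map_himp, w.map_himp]
  map_T a x := by rw [f.map_T, w.map_T]
  map_bot := by rw [f.map_bot, w.map_bot]
  map_top := by rw [f.map_top, w.map_top]

/-! ### The functors and the equivalence -/

section Duality

variable (L : Type v) [DistribLattice L] [BoundedOrder L] [Fintype L] [Nontrivial L]

/-- The spectrum of an `L`-`VL`-algebra as an `L`-Boolean space. -/
def LVA.spec (A : LVA.{max u v} L) : LBS.{max u v} L where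
  carrier := VLPoint L A.carrier
  zeroDim := VLPoint.isTopologicalBasis_isClopen
  α K := {w | ∀ x, w.toFun x ∈ K.carrier}
  isClosed_α K := by
    simp only [Set.ofPred_forall]
    exact isClosed_iInter fun x =>
      ⟨VLPoint.isLocallyConstant_eval x K.carrierᶜ⟩
  α_whole := Set.eq_univ_of_forall fun _ _ => trivial
  α_inter K M := Set.ext fun _ => forall_and

/-- The spectrum functor. -/
def LVA.specFunctor : (LVA.{max u v} L)ᵒᵖ ⥤ LBS.{max u v} L where
  obj A := LVA.spec.{u} L A.unop
  map f :=
    { toFun := fun w => VLPoint.comp w f.unop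
      continuous_toFun := VLPoint.continuous_iff.mpr fun x =>
        VLPoint.isLocallyConstant_eval (f.unop.toFun x)
      map_mem := fun _ _ hw x => hw (f.unop.toFun x) }

/-- The `L`-`VL`-algebra of continuous functions on an `L`-Boolean space. -/
noncomputable def LBS.contAlg (S : LBS.{max u v} L) : LVA.{max u v} L where
  carrier := S.Cont

/-- The functor of continuous functions to `L`. -/
noncomputable def LBS.contFunctor : LBS.{max u v} L ⥤ (LVA.{max u v} L)ᵒᵖ where
  obj S := Opposite.op (LBS.contAlg.{u} L S)
  map {S S'} g := Quiver.Hom.op (V := LVA.{max u v} L) (X := LBS.contAlg.{u} L S')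
    (Y := LBS.contAlg.{u} L S)
    { toFun := fun f => ⟨fun x => f.1 (g.toFun x), f.2.1.comp_continuous g.continuous_toFun,
        fun K x hx => f.2.2 K _ (g.map_mem K x hx)⟩
      map_inf := fun _ _ => rfl
      map_sup := fun _ _ => rfl
      map_himp := fun _ _ => rfl
      map_T := fun _ _ => rfl
      map_bot := rfl
      map_top := rfl }

/-- The evaluation homomorphism from an algebra to the functions on its spectrum. -/
noncomputable def LVA.toCont (A : LVA.{max u v} L) :
    A ⟶ LBS.contAlg.{u} L (LVA.spec.{u} L A) where
  toFun x := ⟨fun w : VLPoint L A.carrier => w.toFun x, VLPoint.isLocallyConstant_eval x,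
    fun _ _ hw => hw x⟩
  map_inf x y := LBS.Cont.ext fun w => VLPoint.map_inf w x y
  map_sup x y := LBS.Cont.ext fun w => VLPoint.map_sup w x y
  map_himp x y := LBS.Cont.ext fun w => VLPoint.map_himp w x y
  map_T a x := LBS.Cont.ext fun w => VLPoint.map_T w a x
  map_bot := LBS.Cont.ext fun w => VLPoint.map_bot w
  map_top := LBS.Cont.ext fun w => VLPoint.map_top w

/-- For surjectivity, subspace preservation is used at `K = w.range`: since `w ∈ α (w.range)`, the
value `f w` is attained by `w`, as gluing requires. -/
theorem LVA.toCont_bijective (A : LVA.{max u v} L) :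
    Function.Bijective (LVA.toCont.{u} L A).toFun := by
  refine ⟨fun x y h => VLPoint.eq_of_forall (L := L) fun w => ?_, fun f => ?_⟩
  · exact congrFun (congrArg Subtype.val h) w
  · obtain ⟨x, hx⟩ := VLPoint.exists_eval_eq (A := A.carrier) f.2.1
      fun w => f.2.2 w.range w fun x => ⟨x, rfl⟩
    exact ⟨x, LBS.Cont.ext hx⟩

/-- The evaluation map from a space to the spectrum of its algebra of functions. -/
noncomputable def LBS.toSpec (S : LBS.{max u v} L) :
    S ⟶ LVA.spec.{u} L (LBS.contAlg.{u} L S) where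
  toFun := LBS.Cont.eval
  continuous_toFun := LBS.Cont.continuous_eval
  map_mem K x hx := (S.mem_α_iff K x).mp hx

/-- The duality between `L`-`VL`-algebras and `L`-Boolean spaces. -/
noncomputable def vlDuality : (LVA.{max u v} L)ᵒᵖ ≌ LBS.{max u v} L :=
  CategoryTheory.Equivalence.mk (LVA.specFunctor.{u} L) (LBS.contFunctor.{u} L)
    (NatIso.ofComponents (F := LVA.specFunctor.{u} L ⋙ LBS.contFunctor.{u} L) (G := 𝟭 _)
      (fun A => (LVA.isoOfBijective _ (LVA.toCont_bijective.{u} L A.unop)).op)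
      fun _ => rfl).symm
    (NatIso.ofComponents (F := 𝟭 _) (G := LBS.contFunctor.{u} L ⋙ LVA.specFunctor.{u} L)
      (fun S => LBS.isoOfBijective (LBS.toSpec.{u} L S)
        ⟨LBS.Cont.eval_injective, LBS.Cont.eval_surjective⟩
        fun K x hx => (S.mem_α_iff K x).mpr hx)
      fun _ => rfl).symm

end Duality

/-- For a finite distributive lattice `L` with `0 ≠ 1`, the category of `L`-`VL`-algebras is
dually equivalent to the category of `L`-Boolean spaces. -/
theorem theorem03 (L : Type v) [DistribLattice L] [BoundedOrder L] [Fintype L] [Nontrivial L] :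
    Nonempty ((LVA.{max u v} L)ᵒᵖ ≌ LBS.{max u v} L) :=
  ⟨vlDuality.{u} L⟩
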